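/- Let $A$ be a coherent quantale: a complete lattice with bottom $0$ and top $1$ together with a commutative associative multiplication that distributes over arbitrary joins and has $1$ as unit, such that every element is a join of compact elements, $1$ is compact, and the product of two compact elements is compact. Let $K(A)$ be the set of compact elements of $A$ and $B(A)$ the set of complemented elements of the lattice $A$; the complement of $e\in B(A)$ is unique and is written $\neg e$. An element $p\neq 1$ is $m$-prime if $ab\le p$ implies $a\le p$ or $b\le p$, for all $a,b\in A$. $\mathrm{Spec}(A)$ is the set of $m$-prime elements, with the Zariski topology, whose open sets are the sets $D(a)=\{p\in \mathrm{Spec}(A) : a\not\le p\}$, $a\in A$. $\mathrm{Max}(A)\subseteq \mathrm{Spec}(A)$ is the set of maximal elements of $A\setminus\{1\}$, and $\mathrm{Max}_Z(A)$ is this set with the subspace topology. The radical of $a$ is $\rho(a)=\bigwedge\{p\in \mathrm{Spec}(A): a\le p\}$, and $R(A)=\{a\in A:\rho(a)=a\}$ is the frame of radical elements, ordered as in $A$ (its meets are those of $A$, its joins are the radicals of the joins in $A$), regarded as a quantale whose multiplication is the meet. The reticulation $L(A)$ is the bounded distributive lattice, unique up to isomorphism, that admits a surjection $\lambda:K(A)\to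 L(A)$ with $\lambda(a\vee b)\le\lambda(a)\vee\lambda(b)$, $\lambda(ab)=\lambda(a)\wedge\lambda(b)$, and $\lambda(a)\le\lambda(b)$ if and only if $a^n\le b$ for some $n\ge1$; concretely it is the quotient of $K(A)$ by the relation "each of $a$, $b$ has a power with exponent at least $1$ below the other". A quantale $Q$ is normal if for all $a,b\in Q$ with $a\vee b=1$ there are $e,f\in Q$ with $a\vee e=b\vee f=1$ and $ef=0$. It is $B$-normal if for all $c,d\in K(Q)$ with $c\vee d=1$ there are $e,f\in B(Q)$ with $c\vee e=d\vee f=1$ and $ef=0$. A bounded distributive lattice $L$ is $B$-normal if for all $x,y\in L$ with $x\vee y=1$ there are complemented elements $e,f$ of $L$ with $x\vee e=y\vee f=1$ and $e\wedge f=0$. A space is zero-dimensional if its clopen sets form a basis of its topology, and Boolean if it is compact, Hausdorff and zero-dimensional. An element of $A$ is regular if it is a join of complemented elements. The Pierce spectrum $\mathrm{Sp}(A)$ is the set of maximal elements of the set of regular elements different from $1$, with the topology generated by the sets $U(e)=\{q\in \mathrm{Sp}(A): e\not\le q\}$, $e\in B(A)$. For $p\in \mathrm{Spec}(A)$ put $s_A(p)=\bigvee\{e\in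 B(A): e\le p\}$; this defines a map $s_A:\mathrm{Spec}(A)\to \mathrm{Sp}(A)$. Theorem 7.13. For a coherent quantale $A$ the following are equivalent: 1. $A$ is $B$-normal; 2. $R(A)$ is a $B$-normal frame; 3. the reticulation $L(A)$ is a $B$-normal lattice; 4. for all distinct $p,q\in \mathrm{Max}(A)$ there exists $e\in B(A)$ such that $e\le p$ and $\neg e\le q$; 5. $A$ is a normal quantale and $\mathrm{Max}_Z(A)$ is a zero-dimensional space; 6. $A$ is a normal quantale and $\mathrm{Max}_Z(A)$ is a Boolean space; 7. the family $(D(e)\cap \mathrm{Max}(A))_{e\in B(A)}$ is a basis of open sets for $\mathrm{Max}_Z(A)$; 8. the map $s_A|_{\mathrm{Max}(A)}:\mathrm{Max}_Z(A)\to \mathrm{Sp}(A)$ is a homeomorphism. -/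

import Mathlib

namespace CohQuantale

open TopologicalSpace

/-! ### Coherent quantales

The ambient structure is a commutative monoid on a complete lattice whose product distributes over
arbitrary joins (`IsQuantale`).  The bottom `0` and the top `1` of the lattice are `⊥` and `⊤`. -/

/-- An integral commutative quantale: the top element is the unit of the multiplication. -/
class IsIntegralQuantale (A : Type*) [CompleteLattice A] [CommMonoid A] : Prop
    extends IsQuantale A where
  one_eq_top : (1 : A) = ⊤

/-- A coherent (integral, commutative) quantale: every element is a join of compact elements,
the top is compact, and compact elements are closed under multiplication. -/
class IsCoherentQuantale (A : Type*) [CompleteLattice A] [CommMonoid A] : Prop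
    extends IsIntegralQuantale A, IsCompactlyGenerated A where
  isCompactElement_top : IsCompactElement (⊤ : A)
  isCompactElement_mul : ∀ c d : A, IsCompactElement c → IsCompactElement d →
    IsCompactElement (c * d)

section Basic

variable {A : Type*} [CompleteLattice A] [CommMonoid A] [IsIntegralQuantale A]

theorem mul_le_left' (a b : A) : a * b ≤ a := by
  have h : a * b ≤ a * 1 := by
    gcongr
    rw [IsIntegralQuantale.one_eq_top]; exact le_top
  simpa using h

theorem mul_le_right' (a b : A) : a * b ≤ b := by
  rw [mul_comm]; exact mul_le_left' b a

theorem top_mul' (a : A) : ⊤ * a = a := by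
  rw [← IsIntegralQuantale.one_eq_top, one_mul]

/-- `(a ∨ b)^(n+m) ≤ a^n ∨ b^m`. -/
theorem sup_pow_le (a b : A) : ∀ n m : ℕ, (a ⊔ b) ^ (n + m) ≤ a ^ n ⊔ b ^ m
  | 0, m => by simp [IsIntegralQuantale.one_eq_top]
  | n + 1, 0 => by simp [IsIntegralQuantale.one_eq_top]
  | n + 1, m + 1 => by
    have h1 := sup_pow_le a b n (m + 1)
    have h2 := sup_pow_le a b (n + 1) m
    have e : (a ⊔ b) ^ (n + 1 + (m + 1)) =
        a * (a ⊔ b) ^ (n + (m + 1)) ⊔ b * (a ⊔ b) ^ (n + 1 + m) := by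
      rw [show n + 1 + (m + 1) = (n + (m + 1)) + 1 by omega,
        show n + 1 + m = n + (m + 1) by omega, pow_succ', Quantale.sup_mul_distrib]
    rw [e]
    refine sup_le ?_ ?_
    · calc a * (a ⊔ b) ^ (n + (m + 1)) ≤ a * (a ^ n ⊔ b ^ (m + 1)) := by gcongr
        _ = a ^ (n + 1) ⊔ a * b ^ (m + 1) := by rw [Quantale.mul_sup_distrib, ← pow_succ']
        _ ≤ _ := sup_le_sup_left (mul_le_right' _ _) _
    · calc b * (a ⊔ b) ^ (n + 1 + m) ≤ b * (a ^ (n + 1) ⊔ b ^ m) := by gcongr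
        _ = b * a ^ (n + 1) ⊔ b ^ (m + 1) := by rw [Quantale.mul_sup_distrib, ← pow_succ']
        _ ≤ _ := sup_le_sup_right (mul_le_right' _ _) _

theorem pow_antitone' (a : A) {n m : ℕ} (h : n ≤ m) : a ^ m ≤ a ^ n := by
  obtain ⟨k, rfl⟩ := Nat.exists_eq_add_of_le h
  rw [pow_add]; exact mul_le_left' _ _

end Basic

section Elements

variable {A : Type*} [CompleteLattice A] [CommMonoid A]

/-- `m`-prime elements. -/
def IsMPrime (p : A) : Prop := p ≠ ⊤ ∧ ∀ a b : A, a * b ≤ p → a ≤ p ∨ b ≤ p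

/-- The radical `ρ(a)`: the meet of all `m`-prime elements above `a`. -/
def rad (a : A) : A := sInf {p | IsMPrime p ∧ a ≤ p}

theorem le_rad (a : A) : a ≤ rad a := le_sInf fun _ hp => hp.2

theorem rad_le_of_isMPrime {a p : A} (hp : IsMPrime p) (h : a ≤ p) : rad a ≤ p :=
  sInf_le ⟨hp, h⟩

theorem rad_mono {a b : A} (h : a ≤ b) : rad a ≤ rad b :=
  le_sInf fun _ hp => rad_le_of_isMPrime hp.1 (h.trans hp.2)

theorem rad_rad (a : A) : rad (rad a) = rad a :=
  le_antisymm (le_sInf fun _ hp => rad_le_of_isMPrime hp.1 (rad_le_of_isMPrime hp.1 hp.2))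
    (le_rad _)

theorem rad_inf {a b : A} (ha : rad a = a) (hb : rad b = b) : rad (a ⊓ b) = a ⊓ b :=
  le_antisymm (le_inf ((rad_mono inf_le_left).trans ha.le) ((rad_mono inf_le_right).trans hb.le))
    (le_rad _)

theorem rad_sInf {S : Set A} (h : ∀ a ∈ S, rad a = a) : rad (sInf S) = sInf S :=
  le_antisymm (le_sInf fun a ha => (rad_mono (sInf_le ha)).trans (h a ha).le) (le_rad _)

end Elements

/-! ### Normal and `B`-normal quantales and lattices -/

/-- A normal quantale. -/
def IsNormalQuantale (A : Type*) [CompleteLattice A] [CommMonoid A] : Prop :=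
  ∀ a b : A, a ⊔ b = ⊤ → ∃ e f : A, a ⊔ e = ⊤ ∧ b ⊔ f = ⊤ ∧ e * f = ⊥

/-- A `B`-normal quantale; the elements of the Boolean center are the complemented elements. -/
def IsBNormalQuantale (A : Type*) [CompleteLattice A] [CommMonoid A] : Prop :=
  ∀ c d : A, IsCompactElement c → IsCompactElement d → c ⊔ d = ⊤ →
    ∃ e f : A, IsComplemented e ∧ IsComplemented f ∧ c ⊔ e = ⊤ ∧ d ⊔ f = ⊤ ∧ e * f = ⊥

/-- A `B`-normal (bounded distributive) lattice. -/
def IsBNormalLattice (L : Type*) [DistribLattice L] [BoundedOrder L] : Prop :=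
  ∀ x y : L, x ⊔ y = ⊤ →
    ∃ e f : L, IsComplemented e ∧ IsComplemented f ∧ x ⊔ e = ⊤ ∧ y ⊔ f = ⊤ ∧ e ⊓ f = ⊥

/-! ### The frame of radical elements -/

/-- `R(A)`: the set of radical elements of `A`, ordered as in `A`. -/
def RadicalElements (A : Type*) [CompleteLattice A] [CommMonoid A] : Type _ :=
  {a : A // rad a = a}

namespace RadicalElements

variable {A : Type*} [CompleteLattice A] [CommMonoid A]

instance : PartialOrder (RadicalElements A) := Subtype.partialOrder _

/-- Meets are computed in `A`, joins are the radicals of the joins in `A`. -/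
instance : CompleteLattice (RadicalElements A) where
  sup a b := ⟨rad (a.1 ⊔ b.1), rad_rad _⟩
  le_sup_left a _ := (le_sup_left : a.1 ≤ _).trans (le_rad _)
  le_sup_right _ b := (le_sup_right : b.1 ≤ _).trans (le_rad _)
  sup_le _ _ c h1 h2 := (rad_mono (sup_le h1 h2)).trans c.2.le
  inf a b := ⟨a.1 ⊓ b.1, rad_inf a.2 b.2⟩
  inf_le_left a b := (inf_le_left : a.1 ⊓ b.1 ≤ a.1)
  inf_le_right a b := (inf_le_right : a.1 ⊓ b.1 ≤ b.1)
  le_inf a b c h1 h2 := (le_inf h1 h2 : a.1 ≤ b.1 ⊓ c.1)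
  sSup S := ⟨rad (sSup (Subtype.val '' S)), rad_rad _⟩
  isLUB_sSup S := by
    refine ⟨fun a ha => ?_, fun b hb => ?_⟩
    · exact (le_sSup (Set.mem_image_of_mem Subtype.val ha)).trans (le_rad _)
    · refine (le_trans (rad_mono (sSup_le ?_)) b.2.le : rad (sSup (Subtype.val '' S)) ≤ b.1)
      rintro _ ⟨a, ha, rfl⟩
      exact hb ha
  sInf S := ⟨sInf (Subtype.val '' S), rad_sInf (by rintro _ ⟨a, -, rfl⟩; exact a.2)⟩
  isGLB_sInf S := by
    refine ⟨fun a ha => ?_, fun b hb => ?_⟩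
    · exact sInf_le (Set.mem_image_of_mem Subtype.val ha)
    · refine (le_sInf ?_ : b.1 ≤ _)
      rintro _ ⟨a, ha, rfl⟩
      exact hb ha
  top := ⟨⊤, le_antisymm le_top (le_rad _)⟩
  le_top a := (le_top : a.1 ≤ ⊤)
  bot := ⟨rad ⊥, rad_rad _⟩
  bot_le a := (rad_mono bot_le).trans a.2.le

/-- In `R(A)` finite meets distribute over arbitrary joins. -/
theorem inf_sSup_distrib [IsIntegralQuantale A] (a : RadicalElements A)
    (S : Set (RadicalElements A)) : a ⊓ sSup S = ⨆ b ∈ S, a ⊓ b := by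
  refine le_antisymm ?_ iSup_inf_le_inf_sSup
  set t : RadicalElements A := ⨆ b ∈ S, a ⊓ b with ht
  have key : ∀ b ∈ S, a.1 * b.1 ≤ t.1 := fun b hb => by
    have h : a ⊓ b ≤ t := le_iSup₂_of_le b hb le_rfl
    exact (le_inf (mul_le_left' _ _) (mul_le_right' _ _)).trans (h : a.1 ⊓ b.1 ≤ t.1)
  change a.1 ⊓ rad (sSup (Subtype.val '' S)) ≤ t.1
  rw [← t.2]
  refine le_sInf ?_
  rintro p ⟨hp, htp⟩
  by_cases hap : a.1 ≤ p
  · exact inf_le_left.trans hap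
  · refine inf_le_right.trans (rad_le_of_isMPrime hp (sSup_le ?_))
    rintro _ ⟨b, hb, rfl⟩
    exact (hp.2 _ _ ((key b hb).trans htp)).resolve_left hap

/-- The multiplication of `R(A)` is the meet. -/
instance : CommMonoid (RadicalElements A) where
  mul a b := a ⊓ b
  mul_assoc := inf_assoc
  mul_comm := inf_comm
  one := ⊤
  one_mul := top_inf_eq
  mul_one := inf_top_eq

/-- `R(A)` is a frame, i.e. a quantale whose multiplication is the meet. -/
instance [IsIntegralQuantale A] : IsIntegralQuantale (RadicalElements A) where
  mul_sSup_distrib a S := inf_sSup_distrib a S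
  sSup_mul_distrib S a := by
    refine (inf_comm (sSup S) a).trans ((inf_sSup_distrib a S).trans ?_)
    exact iSup_congr fun b => iSup_congr fun _ => inf_comm a b
  one_eq_top := rfl

end RadicalElements

/-! ### The reticulation -/

/-- `K(A)`: the compact elements of `A`. -/
abbrev Compacts (A : Type*) [CompleteLattice A] : Type _ := {c : A // IsCompactElement c}

/-- A reticulation of `A`: a bounded distributive lattice `L` with a surjection `lam : K(A) → L`
satisfying the three axioms below (binary joins and products of compact elements are compact). -/
structure IsReticulation {A : Type*} [CompleteLattice A] [CommMonoid A]
    {L : Type*} [DistribLattice L] [BoundedOrder L] (lam : Compacts A → L) : Prop where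
  surjective : Function.Surjective lam
  map_sup_le : ∀ a b c : Compacts A, c.1 = a.1 ⊔ b.1 → lam c ≤ lam a ⊔ lam b
  map_mul : ∀ a b c : Compacts A, c.1 = a.1 * b.1 → lam c = lam a ⊓ lam b
  le_iff : ∀ a b : Compacts A, lam a ≤ lam b ↔ ∃ n : ℕ, 1 ≤ n ∧ a.1 ^ n ≤ b.1

section Reticulation

theorem isCompactElement_sup' {A : Type*} [CompleteLattice A] {a b : A}
    (ha : IsCompactElement a) (hb : IsCompactElement b) : IsCompactElement (a ⊔ b) := by
  intro s u hne hd hu h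
  obtain ⟨x, hx, hax⟩ := ha s u hne hd hu (le_sup_left.trans h)
  obtain ⟨y, hy, hby⟩ := hb s u hne hd hu (le_sup_right.trans h)
  obtain ⟨z, hz, hxz, hyz⟩ := hd x hx y hy
  exact ⟨z, hz, sup_le (hax.trans hxz) (hby.trans hyz)⟩

theorem isCompactElement_bot' {A : Type*} [CompleteLattice A] :
    IsCompactElement (⊥ : A) := fun _ _ ⟨x, hx⟩ _ _ _ => ⟨x, hx, bot_le⟩

variable (A : Type*) [CompleteLattice A] [CommMonoid A]

/-- The preorder on `K(A)`: some power (with exponent at least `1`) of `a` lies below `b`. -/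
def PowLE (a b : Compacts A) : Prop := ∃ n : ℕ, 1 ≤ n ∧ a.1 ^ n ≤ b.1

variable {A}

theorem PowLE.of_le {a b : Compacts A} (h : a.1 ≤ b.1) : PowLE A a b := ⟨1, le_rfl, by simpa⟩

/-- The join of two compact elements. -/
def Compacts.sup (a b : Compacts A) : Compacts A := ⟨a.1 ⊔ b.1, isCompactElement_sup' a.2 b.2⟩

theorem powLE_sup_left (a b : Compacts A) : PowLE A a (a.sup b) := .of_le le_sup_left
theorem powLE_sup_right (a b : Compacts A) : PowLE A b (a.sup b) := .of_le le_sup_right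

variable [IsCoherentQuantale A]

theorem PowLE.trans {a b c : Compacts A} (h1 : PowLE A a b) (h2 : PowLE A b c) :
    PowLE A a c := by
  obtain ⟨n, hn, h1⟩ := h1
  obtain ⟨m, hm, h2⟩ := h2
  refine ⟨n * m, Nat.mul_pos hn hm, ?_⟩
  rw [pow_mul]
  exact (pow_le_pow_left' h1 m).trans h2

/-- The product of two compact elements. -/
def Compacts.mul (a b : Compacts A) : Compacts A :=
  ⟨a.1 * b.1, IsCoherentQuantale.isCompactElement_mul _ _ a.2 b.2⟩

theorem PowLE.sup_le {a b c : Compacts A} (h1 : PowLE A a c) (h2 : PowLE A b c) :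
    PowLE A (a.sup b) c := by
  obtain ⟨n, hn, h1⟩ := h1
  obtain ⟨m, hm, h2⟩ := h2
  exact ⟨n + m, by omega, (sup_pow_le _ _ n m).trans (_root_.sup_le h1 h2)⟩

theorem PowLE.le_mul {a b c : Compacts A} (h1 : PowLE A a b) (h2 : PowLE A a c) :
    PowLE A a (b.mul c) := by
  obtain ⟨n, hn, h1⟩ := h1
  obtain ⟨m, hm, h2⟩ := h2
  refine ⟨n + m, by omega, ?_⟩
  rw [pow_add]
  exact mul_le_mul' h1 h2

theorem mul_powLE_left (a b : Compacts A) : PowLE A (a.mul b) a := .of_le (mul_le_left' _ _)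
theorem mul_powLE_right (a b : Compacts A) : PowLE A (a.mul b) b := .of_le (mul_le_right' _ _)

variable (A) in
/-- The equivalence relation on `K(A)` that identifies `a` and `b` when each of them has a power
below the other one. -/
def retSetoid : Setoid (Compacts A) where
  r a b := PowLE A a b ∧ PowLE A b a
  iseqv := ⟨fun _ => ⟨.of_le le_rfl, .of_le le_rfl⟩, fun h => ⟨h.2, h.1⟩,
    fun h1 h2 => ⟨h1.1.trans h2.1, h2.2.trans h1.2⟩⟩

variable (A) in
/-- The reticulation `L(A)`, as the quotient of `K(A)` by the equivalence relation above. -/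
def Reticulation : Type _ := Quotient (retSetoid A)

namespace Reticulation

/-- The canonical map `λ : K(A) → L(A)`. -/
def lam (c : Compacts A) : Reticulation A := Quotient.mk (retSetoid A) c

instance : LE (Reticulation A) where
  le := Quotient.lift₂ (s₁ := retSetoid A) (s₂ := retSetoid A) (PowLE A) fun _ _ _ _ h1 h2 =>
    propext ⟨fun h => (h1.2.trans h).trans h2.1, fun h => (h1.1.trans h).trans h2.2⟩

instance : PartialOrder (Reticulation A) where
  le_refl x := Quotient.inductionOn x fun _ => PowLE.of_le le_rfl
  le_trans x y z := Quotient.inductionOn₃ x y z fun _ _ _ h1 h2 => PowLE.trans h1 h2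
  le_antisymm x y := Quotient.inductionOn₂ x y fun _ _ h1 h2 => Quotient.sound ⟨h1, h2⟩

/-- Joins are induced by joins, and meets by products, of compact elements. -/
instance : DistribLattice (Reticulation A) where
  sup := Quotient.map₂ Compacts.sup fun _ _ h1 _ _ h2 =>
    ⟨(h1.1.trans (powLE_sup_left _ _)).sup_le (h2.1.trans (powLE_sup_right _ _)),
      (h1.2.trans (powLE_sup_left _ _)).sup_le (h2.2.trans (powLE_sup_right _ _))⟩
  le_sup_left x y := Quotient.inductionOn₂ x y powLE_sup_left
  le_sup_right x y := Quotient.inductionOn₂ x y powLE_sup_right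
  sup_le x y z := Quotient.inductionOn₃ x y z fun _ _ _ h1 h2 => PowLE.sup_le h1 h2
  inf := Quotient.map₂ Compacts.mul fun _ _ h1 _ _ h2 =>
    ⟨((mul_powLE_left _ _).trans h1.1).le_mul ((mul_powLE_right _ _).trans h2.1),
      ((mul_powLE_left _ _).trans h1.2).le_mul ((mul_powLE_right _ _).trans h2.2)⟩
  inf_le_left x y := Quotient.inductionOn₂ x y mul_powLE_left
  inf_le_right x y := Quotient.inductionOn₂ x y mul_powLE_right
  le_inf x y z := Quotient.inductionOn₃ x y z fun _ _ _ h1 h2 => PowLE.le_mul h1 h2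
  le_sup_inf x y z := Quotient.inductionOn₃ x y z fun a b c => by
    refine PowLE.of_le ?_
    change (a.1 ⊔ b.1) * (a.1 ⊔ c.1) ≤ a.1 ⊔ b.1 * c.1
    rw [Quantale.sup_mul_distrib, Quantale.mul_sup_distrib (x := b.1)]
    exact sup_le ((mul_le_left' _ _).trans le_sup_left)
      (sup_le ((mul_le_right' _ _).trans le_sup_left) le_sup_right)

instance : BoundedOrder (Reticulation A) where
  top := lam ⟨⊤, IsCoherentQuantale.isCompactElement_top⟩
  le_top x := Quotient.inductionOn x fun _ => PowLE.of_le le_top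
  bot := lam ⟨⊥, isCompactElement_bot'⟩
  bot_le x := Quotient.inductionOn x fun _ => PowLE.of_le bot_le

/-- `L(A)` with the canonical map is a reticulation of `A`. -/
theorem isReticulation : IsReticulation (lam : Compacts A → Reticulation A) where
  surjective := Quotient.mk_surjective
  map_sup_le a b c h := by
    obtain rfl : c = a.sup b := Subtype.ext h
    exact le_rfl
  map_mul a b c h := by
    obtain rfl : c = a.mul b := Subtype.ext h
    rfl
  le_iff _ _ := Iff.rfl

/-- Every reticulation of `A` is isomorphic to `L(A)`, compatibly with the canonical maps. -/
theorem exists_orderIso {L : Type*} [DistribLattice L] [BoundedOrder L] {mu : Compacts A → L}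
    (h : IsReticulation mu) : ∃ φ : Reticulation A ≃o L, ∀ c, φ (lam c) = mu c := by
  choose g hg using h.surjective
  have hle : ∀ a b : Compacts A, mu a ≤ mu b ↔ lam a ≤ lam b := h.le_iff
  let f : Reticulation A → L := Quotient.lift mu fun a b hab =>
    le_antisymm ((hle a b).2 hab.1) ((hle b a).2 hab.2)
  have hf : ∀ c, f (lam c) = mu c := fun _ => rfl
  refine ⟨{ toFun := f, invFun := fun y => lam (g y), left_inv := ?_, right_inv := ?_,
            map_rel_iff' := ?_ }, hf⟩
  · refine fun x => Quotient.inductionOn x fun c => ?_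
    have e : mu (g (mu c)) = mu c := hg _
    exact le_antisymm ((hle _ _).1 e.le) ((hle _ _).1 e.ge)
  · exact fun y => (hf _).trans (hg y)
  · intro x y
    exact Quotient.inductionOn₂ x y fun a b => hle a b

end Reticulation

end Reticulation

/-! ### Spectra -/

section Spectra

variable (A : Type*) [CompleteLattice A] [CommMonoid A]

/-- `Spec(A)`: the `m`-prime elements of `A`. -/
def PrimeSpec : Type _ := {p : A // IsMPrime p}

/-- `Max(A)`: the maximal elements of `A` (maximal among the elements different from `⊤`). -/
def MaxSpec : Type _ := {m : A // IsCoatom m}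

variable {A}

/-- `D(a) = {p ∈ Spec(A) | a ≰ p}`. -/
def D (a : A) : Set (PrimeSpec A) := {p | ¬ a ≤ p.1}

variable [IsIntegralQuantale A]

/-- The Zariski topology on `Spec(A)`: the open sets are the sets `D(a)`, `a ∈ A`. -/
instance : TopologicalSpace (PrimeSpec A) where
  IsOpen U := ∃ a : A, U = D a
  isOpen_univ := ⟨⊤, (Set.eq_univ_of_forall fun p h => p.2.1 (top_le_iff.1 h)).symm⟩
  isOpen_inter := by
    rintro _ _ ⟨a, rfl⟩ ⟨b, rfl⟩
    refine ⟨a * b, Set.ext fun p => ⟨fun h hab => ?_, fun h => ⟨fun ha => ?_, fun hb => ?_⟩⟩⟩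
    · exact (p.2.2 a b hab).elim h.1 h.2
    · exact h ((mul_le_left' a b).trans ha)
    · exact h ((mul_le_right' a b).trans hb)
  isOpen_sUnion := by
    intro S hS
    refine ⟨sSup {a | D a ∈ S}, Set.ext fun p => ⟨?_, fun h => ?_⟩⟩
    · rintro ⟨U, hU, hp⟩ hle
      obtain ⟨a, rfl⟩ := hS U hU
      exact hp ((le_sSup (show a ∈ {a | D a ∈ S} from hU)).trans hle)
    · by_contra hcon
      refine h (sSup_le fun a ha => ?_)
      by_contra hap
      exact hcon ⟨D a, ha, hap⟩

/-- Maximal elements are `m`-prime. -/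
theorem isMPrime_of_isCoatom {m : A} (hm : IsCoatom m) : IsMPrime m := by
  refine ⟨hm.1, fun a b hab => ?_⟩
  by_contra! h
  have ha : m ⊔ a = ⊤ := hm.2 _ (left_lt_sup.2 h.1)
  have hb : m ⊔ b = ⊤ := hm.2 _ (left_lt_sup.2 h.2)
  have : (⊤ : A) ≤ m := by
    calc (⊤ : A) = (m ⊔ a) * (m ⊔ b) := by rw [ha, hb, top_mul']
      _ = m * (m ⊔ b) ⊔ (a * m ⊔ a * b) := by
        rw [Quantale.sup_mul_distrib, Quantale.mul_sup_distrib (x := a)]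
      _ ≤ m := sup_le (mul_le_left' _ _) (sup_le (mul_le_right' _ _) hab)
  exact hm.1 (top_le_iff.1 this)

/-- The inclusion `Max(A) ⊆ Spec(A)`. -/
def MaxSpec.toPrimeSpec (m : MaxSpec A) : PrimeSpec A := ⟨m.1, isMPrime_of_isCoatom m.2⟩

/-- `Max_Z(A)`: the maximal spectrum, as a subspace of `Spec(A)` with the Zariski topology. -/
instance : TopologicalSpace (MaxSpec A) :=
  TopologicalSpace.induced MaxSpec.toPrimeSpec inferInstance

end Spectra

/-! ### The Pierce spectrum -/

section Pierce

variable {A : Type*} [CompleteLattice A]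

/-- Regular elements: joins of complemented elements. -/
def IsRegularElement (a : A) : Prop := ∃ S : Set A, (∀ e ∈ S, IsComplemented e) ∧ sSup S = a

variable (A) in
/-- The Pierce spectrum `Sp(A)`: the max-regular elements of `A`, i.e. the maximal elements of the
set of proper regular elements. -/
def PierceSpec : Type _ := {q : A // Maximal (fun a : A => IsRegularElement a ∧ a ≠ ⊤) q}

/-- The topology of `Sp(A)` generated by the sets `U(e) = {q | e ≰ q}`, `e` complemented. -/
instance : TopologicalSpace (PierceSpec A) :=
  TopologicalSpace.generateFrom
    {U | ∃ e : A, IsComplemented e ∧ U = {q : PierceSpec A | ¬ e ≤ q.1}}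

/-- `s_A(p)`: the join of the complemented elements below `p`. -/
def regularPart (p : A) : A := sSup {e | IsComplemented e ∧ e ≤ p}

theorem regularPart_le (p : A) : regularPart p ≤ p := sSup_le fun _ he => he.2

variable [CommMonoid A] [IsIntegralQuantale A]

/-- `s_A(p)` is max-regular for every `m`-prime element `p`. -/
theorem maximal_regularPart {p : A} (hp : IsMPrime p) :
    Maximal (fun a : A => IsRegularElement a ∧ a ≠ ⊤) (regularPart p) := by
  refine ⟨⟨⟨_, fun e he => he.1, rfl⟩, fun h => hp.1 (top_le_iff.1 (h ▸ regularPart_le p))⟩, ?_⟩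
  rintro q ⟨⟨S, hS, rfl⟩, hq⟩ hle
  refine sSup_le fun e he => ?_
  obtain ⟨f, hf⟩ := hS e he
  have hef : e * f ≤ p := by
    refine le_trans (le_inf (mul_le_left' _ _) (mul_le_right' _ _)) ?_
    rw [hf.inf_eq_bot]; exact bot_le
  rcases hp.2 e f hef with h | h
  · exact le_sSup ⟨hS e he, h⟩
  · exfalso
    have hfq : f ≤ sSup S := le_trans (le_sSup (show f ∈ {e | IsComplemented e ∧ e ≤ p} from
      ⟨⟨e, hf.symm⟩, h⟩)) hle
    exact hq (top_le_iff.1 (hf.sup_eq_top ▸ sup_le (le_sSup he) hfq))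

/-- The map `s_A : Spec(A) → Sp(A)`. -/
def pierceMap (p : PrimeSpec A) : PierceSpec A := ⟨regularPart p.1, maximal_regularPart p.2⟩

end Pierce

/-! ### Topological notions -/

/-- Zero-dimensional spaces: the clopen sets form a basis of the topology. -/
def IsZeroDimensional (X : Type*) [TopologicalSpace X] : Prop :=
  IsTopologicalBasis {U : Set X | IsClopen U}

/-- Boolean spaces: compact Hausdorff zero-dimensional spaces. -/
def IsBooleanSpace (X : Type*) [TopologicalSpace X] : Prop :=
  CompactSpace X ∧ T2Space X ∧ IsZeroDimensional X

end CohQuantale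

/-!
Call a codisjoint pair `a ⊔ b = ⊤` *split* if there are complements `e ≤ a` and `f ≤ b`. Each
form of `B`-normality says that all codisjoint pairs of the lattice in question are split.
Complements modulo `rad ⊥` can be corrected to genuine complements by passing to large powers, so
this property is shared by `A`, the frame of radical elements and the reticulation.

Distinct coatoms are codisjoint, so splitting separates them. Conversely, if coatoms are separated,
then a coatom `m` is the only one above `s_A(m)`, and compactness of `⊤` turns this into splitting.
Two coatoms are separated precisely when `s_A` distinguishes them, and `s_A` is a continuous
surjection from the compact space `Max_Z(A)` onto the Hausdorff space `Sp(A)`. Finally, in a normal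
quantale every clopen subset of `Max_Z(A)` is cut out by a complemented element.
-/

namespace CohQuantale

open TopologicalSpace

/-- The splitting property: every codisjoint pair lies above a pair of complements. It is the form
of `B`-normality that makes sense in any bounded order and does not mention compactness. -/
def SplitsCodisjoint (L : Type*) [PartialOrder L] [BoundedOrder L] : Prop :=
  ∀ ⦃a b : L⦄, Codisjoint a b → ∃ e f : L, IsCompl e f ∧ e ≤ a ∧ f ≤ b

/-- Separation of the maximal elements by complements, `f` playing the role of `¬e`. -/
def SeparatesCoatoms (L : Type*) [PartialOrder L] [BoundedOrder L] : Prop :=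
  ∀ p q : L, IsCoatom p → IsCoatom q → p ≠ q → ∃ e f : L, IsCompl e f ∧ e ≤ p ∧ f ≤ q

theorem SplitsCodisjoint.separatesCoatoms {L : Type*} [Lattice L] [BoundedOrder L]
    (hL : SplitsCodisjoint L) : SeparatesCoatoms L :=
  fun _ _ hp hq hpq => hL (hp.codisjoint_of_ne hq hpq)

theorem isBNormalLattice_iff_splitsCodisjoint {L : Type*} [DistribLattice L] [BoundedOrder L] :
    IsBNormalLattice L ↔ SplitsCodisjoint L := by
  constructor
  · intro hL a b hab
    obtain ⟨e, f, ⟨e', he⟩, -, hae, hbf, hef⟩ := hL a b hab.eq_top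
    exact ⟨e', e, he.symm, he.symm.disjoint.le_of_codisjoint (codisjoint_iff.2 hae).symm,
      (disjoint_iff.2 hef).le_of_codisjoint (codisjoint_iff.2 hbf).symm⟩
  · intro hL a b hab
    obtain ⟨e, f, hef, hea, hfb⟩ := hL (codisjoint_iff.2 hab)
    exact ⟨f, e, ⟨e, hef.symm⟩, ⟨f, hef⟩, (hef.codisjoint.mono_left hea).eq_top,
      (hef.symm.codisjoint.mono_left hfb).eq_top, hef.symm.inf_eq_bot⟩

theorem codisjoint_iff_forall_isCoatom {L : Type*} [SemilatticeSup L] [OrderTop L] [IsCoatomic L]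
    {a b : L} : Codisjoint a b ↔ ∀ m, IsCoatom m → a ≤ m → ¬ b ≤ m := by
  refine ⟨fun h m hm ha hb => hm.1 (top_le_iff.1 (h ha hb)), fun h => codisjoint_iff.2 ?_⟩
  refine (eq_top_or_exists_le_coatom (a ⊔ b)).resolve_right ?_
  rintro ⟨m, hm, hab⟩
  exact h m hm (le_sup_left.trans hab) (le_sup_right.trans hab)

section CompleteLattice

variable {L : Type*} [CompleteLattice L]

theorem exists_codisjoint_of_directedOn (htop : IsCompactElement (⊤ : L)) {a : L} {S : Set L}
    (hne : S.Nonempty) (hdir : DirectedOn (· ≤ ·) S) (h : Codisjoint a (sSup S)) :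
    ∃ s ∈ S, Codisjoint a s := by
  have hdir' : DirectedOn (· ≤ ·) ((a ⊔ ·) '' S) :=
    directedOn_image.2 (hdir.mono fun _ _ hxy => sup_le_sup_left hxy a)
  have hcover : ⊤ ≤ sSup ((a ⊔ ·) '' S) := by
    rw [sSup_image, ← sup_biSup hne, ← sSup_eq_iSup, h.eq_top]
  obtain ⟨_, ⟨s, hs, rfl⟩, hst⟩ := htop _ _ (hne.image _) hdir' (isLUB_sSup _) hcover
  exact ⟨s, hs, codisjoint_iff_le_sup.2 hst⟩

theorem exists_isCompactElement_codisjoint [IsCompactlyGenerated L]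
    (htop : IsCompactElement (⊤ : L)) {a b : L} (h : Codisjoint a b) :
    ∃ c, IsCompactElement c ∧ c ≤ b ∧ Codisjoint a c := by
  rw [← sSup_compact_le_eq b] at h
  obtain ⟨c, ⟨hc, hcb⟩, hac⟩ := exists_codisjoint_of_directedOn
    (S := {c | IsCompactElement c ∧ c ≤ b}) htop ⟨⊥, isCompactElement_bot', bot_le⟩
    (fun x hx y hy => ⟨x ⊔ y, ⟨isCompactElement_sup' hx.1 hy.1, sup_le hx.2 hy.2⟩,
      le_sup_left, le_sup_right⟩) h
  exact ⟨c, hc, hcb, hac⟩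

theorem exists_isCompactElement_codisjoint_pair [IsCompactlyGenerated L]
    (htop : IsCompactElement (⊤ : L)) {a b : L} (h : Codisjoint a b) :
    ∃ c d, IsCompactElement c ∧ IsCompactElement d ∧ c ≤ a ∧ d ≤ b ∧ Codisjoint c d := by
  obtain ⟨d, hd, hdb, had⟩ := exists_isCompactElement_codisjoint htop h
  obtain ⟨c, hc, hca, hdc⟩ := exists_isCompactElement_codisjoint htop had.symm
  exact ⟨c, d, hc, hd, hca, hdb, hdc.symm⟩

theorem le_regularPart_iff {e p : L} (he : IsComplemented e) : e ≤ regularPart p ↔ e ≤ p :=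
  ⟨fun h => h.trans (regularPart_le p), fun h => le_sSup ⟨he, h⟩⟩

end CompleteLattice

section Integral

variable {A : Type*} [CompleteLattice A] [CommMonoid A] [IsIntegralQuantale A]

theorem mul_le_inf (a b : A) : a * b ≤ a ⊓ b :=
  le_inf (mul_le_left' a b) (mul_le_right' a b)

theorem mul_eq_bot_of_disjoint {a b : A} (h : Disjoint a b) : a * b = ⊥ :=
  le_bot_iff.1 ((mul_le_inf a b).trans h.le_bot)

theorem sup_mul_sup_le (a x y : A) : (a ⊔ x) * (a ⊔ y) ≤ a ⊔ x * y := by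
  rw [Quantale.sup_mul_distrib, Quantale.mul_sup_distrib (x := x)]
  exact sup_le ((mul_le_left' _ _).trans le_sup_left)
    (sup_le_sup_right (mul_le_right' _ _) _)

theorem le_of_codisjoint_of_mul_le {a b x y : A} (h : Codisjoint a b) (ha : a * x ≤ y)
    (hb : b * x ≤ y) : x ≤ y := by
  rw [← top_mul' x, ← h.eq_top, Quantale.sup_mul_distrib]
  exact sup_le ha hb

theorem le_of_codisjoint_of_mul_eq_bot {a e f : A} (h : Codisjoint a e) (hef : e * f = ⊥) :
    f ≤ a :=
  le_of_codisjoint_of_mul_le h (mul_le_left' a f) (hef.le.trans bot_le)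

theorem codisjoint_mul_right {a x y : A} (hx : Codisjoint a x) (hy : Codisjoint a y) :
    Codisjoint a (x * y) := by
  have h := sup_mul_sup_le a x y
  rw [hx.eq_top, hy.eq_top, top_mul'] at h
  exact codisjoint_iff_le_sup.2 h

theorem codisjoint_pow {a b : A} (h : Codisjoint a b) (n m : ℕ) :
    Codisjoint (a ^ n) (b ^ m) := by
  have hpow := sup_pow_le a b n m
  rw [h.eq_top, ← IsIntegralQuantale.one_eq_top, one_pow, IsIntegralQuantale.one_eq_top] at hpow
  exact codisjoint_iff_le_sup.2 hpow

theorem isCompl_iff_mul_eq_bot {e f : A} : IsCompl e f ↔ Codisjoint e f ∧ e * f = ⊥ := by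
  refine ⟨fun h => ⟨h.codisjoint, mul_eq_bot_of_disjoint h.disjoint⟩, fun ⟨h, hef⟩ => ⟨?_, h⟩⟩
  have hinf : e ⊓ f ≤ e * f := le_of_codisjoint_of_mul_le h (mul_le_mul_right inf_le_right e)
    ((mul_comm f _).le.trans (mul_le_mul_left inf_le_left f))
  exact disjoint_iff_inf_le.2 (hinf.trans hef.le)

theorem isCompl_sup_mul {e e' f f' : A} (he : IsCompl e e') (hf : IsCompl f f') :
    IsCompl (e ⊔ f) (e' * f') := by
  refine isCompl_iff_mul_eq_bot.2 ⟨codisjoint_mul_right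
    (he.codisjoint.mono_left le_sup_left) (hf.codisjoint.mono_left le_sup_right), ?_⟩
  rw [Quantale.sup_mul_distrib, ← mul_assoc, mul_eq_bot_of_disjoint he.disjoint, mul_left_comm,
    mul_eq_bot_of_disjoint hf.disjoint, Quantale.bot_mul, Quantale.mul_bot, sup_idem]

theorem isCompactElement_of_isComplemented (htop : IsCompactElement (⊤ : A)) {e : A}
    (he : IsComplemented e) : IsCompactElement e := by
  obtain ⟨f, hef⟩ := he
  rw [CompleteLattice.isCompactElement_iff_le_of_directed_sSup_le]
  intro S hne hdir hle
  obtain ⟨s, hs, hfs⟩ := exists_codisjoint_of_directedOn htop hne hdir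
    (hef.symm.codisjoint.mono_right hle)
  exact ⟨s, hs, le_of_codisjoint_of_mul_eq_bot hfs.symm
    (mul_eq_bot_of_disjoint hef.symm.disjoint)⟩

theorem codisjoint_regularPart_iff (htop : IsCompactElement (⊤ : A)) {a b : A} :
    Codisjoint a (regularPart b) ↔ ∃ e f, IsCompl e f ∧ e ≤ a ∧ f ≤ b := by
  constructor
  · intro h
    obtain ⟨f, ⟨⟨e, hfe⟩, hfb⟩, haf⟩ := exists_codisjoint_of_directedOn
      (S := {f | IsComplemented f ∧ f ≤ b}) htop ⟨⊥, isComplemented_bot, bot_le⟩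
      (fun x ⟨⟨x', hx⟩, hxb⟩ y ⟨⟨y', hy⟩, hyb⟩ =>
        ⟨x ⊔ y, ⟨⟨_, isCompl_sup_mul hx hy⟩, sup_le hxb hyb⟩, le_sup_left, le_sup_right⟩) h
    exact ⟨e, f, hfe.symm,
      le_of_codisjoint_of_mul_eq_bot haf (mul_eq_bot_of_disjoint hfe.disjoint), hfb⟩
  · rintro ⟨e, f, hef, hea, hfb⟩
    exact hef.codisjoint.mono hea ((le_regularPart_iff ⟨e, hef.symm⟩).2 hfb)

theorem isBNormalQuantale_iff_splitsCodisjoint [IsCompactlyGenerated A]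
    (htop : IsCompactElement (⊤ : A)) : IsBNormalQuantale A ↔ SplitsCodisjoint A := by
  constructor
  · intro hA a b hab
    obtain ⟨c, d, hc, hd, hca, hdb, hcd⟩ := exists_isCompactElement_codisjoint_pair htop hab
    obtain ⟨e, f, ⟨e', he⟩, -, hce, hdf, hef⟩ := hA c d hc hd hcd.eq_top
    have he'c : e' ≤ c := le_of_codisjoint_of_mul_eq_bot (codisjoint_iff.2 hce)
      (mul_eq_bot_of_disjoint he.disjoint)
    have hed : e ≤ d := le_of_codisjoint_of_mul_eq_bot (codisjoint_iff.2 hdf)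
      ((mul_comm f e).trans hef)
    exact ⟨e', e, he.symm, he'c.trans hca, hed.trans hdb⟩
  · intro hA c d _ _ hcd
    obtain ⟨e, f, hef, hec, hfd⟩ := hA (codisjoint_iff.2 hcd)
    exact ⟨f, e, ⟨e, hef.symm⟩, ⟨f, hef⟩, (hef.codisjoint.mono_left hec).eq_top,
      (hef.symm.codisjoint.mono_left hfd).eq_top, mul_eq_bot_of_disjoint hef.symm.disjoint⟩

theorem SplitsCodisjoint.isNormalQuantale (hA : SplitsCodisjoint A) : IsNormalQuantale A := by
  intro a b hab
  obtain ⟨e, f, hef, hea, hfb⟩ := hA (codisjoint_iff.2 hab)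
  exact ⟨f, e, (hef.codisjoint.mono_left hea).eq_top,
    (hef.symm.codisjoint.mono_left hfb).eq_top, mul_eq_bot_of_disjoint hef.symm.disjoint⟩

end Integral

namespace IsMPrime

variable {A : Type*} [CompleteLattice A] [CommMonoid A] {p q : A}

theorem not_le_of_codisjoint (hp : IsMPrime p) {a b : A} (h : Codisjoint a b) (ha : a ≤ p) :
    ¬ b ≤ p :=
  fun hb => hp.1 (top_le_iff.1 (h ha hb))

variable [IsIntegralQuantale A]

theorem le_of_pow_le (hp : IsMPrime p) {a : A} {n : ℕ} (h : a ^ n ≤ p) : a ≤ p := by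
  induction n with
  | zero =>
    rw [pow_zero, IsIntegralQuantale.one_eq_top] at h
    exact absurd (top_le_iff.1 h) hp.1
  | succ n ih =>
    rw [pow_succ] at h
    exact (hp.2 _ _ h).elim ih id

theorem not_le_iff_of_isCompl (hp : IsMPrime p) {e f : A} (h : IsCompl e f) :
    ¬ e ≤ p ↔ f ≤ p := by
  refine ⟨(hp.2 e f ?_).resolve_left, hp.not_le_of_codisjoint h.symm.codisjoint⟩
  exact (mul_eq_bot_of_disjoint h.disjoint).le.trans bot_le

theorem exists_isCompl_le_iff (hp : IsMPrime p) (hq : IsMPrime q) :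
    (∃ e f, IsCompl e f ∧ e ≤ p ∧ f ≤ q) ↔ regularPart p ≠ regularPart q := by
  constructor
  · rintro ⟨e, f, hef, hep, hfq⟩ heq
    have heq' : e ≤ regularPart q := heq ▸ (le_regularPart_iff ⟨f, hef⟩).2 hep
    exact (hq.not_le_iff_of_isCompl hef).2 hfq (heq'.trans (regularPart_le q))
  · contrapose!
    intro h
    have hle : regularPart p ≤ regularPart q := sSup_le fun e ⟨⟨f, hef⟩, hep⟩ =>
      (le_regularPart_iff ⟨f, hef⟩).2
        ((hq.not_le_iff_of_isCompl hef.symm).1 (h e f hef hep))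
    exact (maximal_regularPart hp).eq_of_le (maximal_regularPart hq).prop hle

end IsMPrime

theorem SeparatesCoatoms.splitsCodisjoint {A : Type*} [CompleteLattice A] [CommMonoid A]
    [IsIntegralQuantale A] (htop : IsCompactElement (⊤ : A)) (hA : SeparatesCoatoms A) :
    SplitsCodisjoint A := by
  have : IsCoatomic A := CompleteLattice.coatomic_of_top_compact htop
  intro a b hab
  rw [← codisjoint_regularPart_iff htop, codisjoint_iff_forall_isCoatom]
  intro m hm ham hbm
  have hmp : IsMPrime m := isMPrime_of_isCoatom hm
  have unique_above : ∀ n, IsCoatom n → regularPart m ≤ n → m = n := by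
    intro n hn hmn
    by_contra hne
    obtain ⟨e, f, hef, hem, hfn⟩ := hA m n hm hn hne
    exact (isMPrime_of_isCoatom hn).not_le_of_codisjoint hef.symm.codisjoint hfn
      (((le_regularPart_iff ⟨f, hef⟩).2 hem).trans hmn)
  have hb : Codisjoint b (regularPart m) := by
    refine codisjoint_iff_forall_isCoatom.2 fun n hn hbn hmn => ?_
    obtain rfl := unique_above n hn hmn
    exact hmp.not_le_of_codisjoint hab ham hbn
  obtain ⟨e, f, hef, heb, hfm⟩ := (codisjoint_regularPart_iff htop).1 hb
  exact (hmp.not_le_iff_of_isCompl hef).2 hfm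
    (((le_regularPart_iff ⟨f, hef⟩).2 heb).trans hbm)

theorem splitsCodisjoint_iff_separatesCoatoms {A : Type*} [CompleteLattice A] [CommMonoid A]
    [IsIntegralQuantale A] (htop : IsCompactElement (⊤ : A)) :
    SplitsCodisjoint A ↔ SeparatesCoatoms A :=
  ⟨SplitsCodisjoint.separatesCoatoms, SeparatesCoatoms.splitsCodisjoint htop⟩

section Radical

variable {A : Type*} [CompleteLattice A] [CommMonoid A]

section Integral

variable [IsIntegralQuantale A]

theorem rad_mul (a b : A) : rad (a * b) = rad a ⊓ rad b :=
  le_antisymm (le_inf (rad_mono (mul_le_left' a b)) (rad_mono (mul_le_right' a b)))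
    (le_sInf fun _ hp => (hp.1.2 _ _ hp.2).elim
      (fun h => inf_le_left.trans (rad_le_of_isMPrime hp.1 h))
      (fun h => inf_le_right.trans (rad_le_of_isMPrime hp.1 h)))

theorem rad_eq_top_iff [IsCoatomic A] {a : A} : rad a = ⊤ ↔ a = ⊤ := by
  refine ⟨fun h => ?_, fun h => top_le_iff.1 (h ▸ le_rad a)⟩
  refine (eq_top_or_exists_le_coatom a).resolve_right ?_
  rintro ⟨m, hm, ham⟩
  exact hm.1 (top_le_iff.1 (h ▸ rad_le_of_isMPrime (isMPrime_of_isCoatom hm) ham))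

theorem le_rad_of_pow_le {a b : A} {n : ℕ} (h : a ^ n ≤ b) : a ≤ rad b :=
  le_sInf fun _ hp => hp.1.le_of_pow_le (h.trans hp.2)

theorem isMPrime_of_maximal_not_pow_le {c p : A}
    (hp : Maximal (fun x => ∀ n : ℕ, ¬ c ^ n ≤ x) p) : IsMPrime p := by
  refine ⟨fun h => hp.prop 0 (h ▸ le_top), fun x y hxy => ?_⟩
  have exists_pow_le : ∀ z, ¬ z ≤ p → ∃ n : ℕ, c ^ n ≤ p ⊔ z := fun z hz => by
    by_contra! h
    exact hz (le_sup_right.trans (hp.2 h le_sup_left))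
  by_contra! h
  obtain ⟨n, hn⟩ := exists_pow_le x h.1
  obtain ⟨m, hm⟩ := exists_pow_le y h.2
  refine hp.prop (n + m) ?_
  calc c ^ (n + m) = c ^ n * c ^ m := pow_add c n m
    _ ≤ (p ⊔ x) * (p ⊔ y) := mul_le_mul' hn hm
    _ ≤ p ⊔ x * y := sup_mul_sup_le p x y
    _ ≤ p := sup_le le_rfl hxy

end Integral

variable [IsCoherentQuantale A]

instance : IsCoatomic A :=
  CompleteLattice.coatomic_of_top_compact IsCoherentQuantale.isCompactElement_top

theorem isCompactElement_pow {c : A} (hc : IsCompactElement c) (n : ℕ) :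
    IsCompactElement (c ^ n) := by
  induction n with
  | zero =>
    rw [pow_zero, IsIntegralQuantale.one_eq_top]
    exact IsCoherentQuantale.isCompactElement_top
  | succ n ih =>
    rw [pow_succ]
    exact IsCoherentQuantale.isCompactElement_mul _ _ ih hc

theorem exists_isMPrime_not_le {a c : A} (hc : IsCompactElement c) (h : ∀ n : ℕ, ¬ c ^ n ≤ a) :
    ∃ p, IsMPrime p ∧ a ≤ p ∧ ¬ c ≤ p := by
  obtain ⟨p, hap, hp⟩ := zorn_le_nonempty₀ {x : A | ∀ n : ℕ, ¬ c ^ n ≤ x} (by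
    intro S hS hchain y hy
    refine ⟨sSup S, fun n hn => ?_, fun z hz => le_sSup hz⟩
    obtain ⟨x, hx, hcx⟩ := isCompactElement_pow hc n S _ ⟨y, hy⟩ hchain.directedOn
      (isLUB_sSup S) hn
    exact hS hx n hcx) a h
  exact ⟨p, isMPrime_of_maximal_not_pow_le hp, hap, by simpa only [pow_one] using hp.prop 1⟩

theorem le_rad_iff_exists_pow_le {a c : A} (hc : IsCompactElement c) :
    c ≤ rad a ↔ ∃ n : ℕ, c ^ n ≤ a := by
  refine ⟨fun h => ?_, fun ⟨_, h⟩ => le_rad_of_pow_le h⟩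
  by_contra! hpow
  obtain ⟨p, hp, hap, hcp⟩ := exists_isMPrime_not_le hc hpow
  exact hcp (h.trans (rad_le_of_isMPrime hp hap))

theorem exists_isCompl_le_of_le_rad {a b x y : A} (hxy : Codisjoint x y) (hbot : x * y ≤ rad ⊥)
    (hxa : x ≤ rad a) (hyb : y ≤ rad b) : ∃ e f, IsCompl e f ∧ e ≤ a ∧ f ≤ b := by
  obtain ⟨c, d, hc, hd, hcx, hdy, hcd⟩ :=
    exists_isCompactElement_codisjoint_pair IsCoherentQuantale.isCompactElement_top hxy
  obtain ⟨n, hn⟩ := (le_rad_iff_exists_pow_le hc).1 (hcx.trans hxa)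
  obtain ⟨m, hm⟩ := (le_rad_iff_exists_pow_le hd).1 (hdy.trans hyb)
  obtain ⟨k, hk⟩ := (le_rad_iff_exists_pow_le
    (IsCoherentQuantale.isCompactElement_mul c d hc hd)).1 ((mul_le_mul' hcx hdy).trans hbot)
  have hcompl : IsCompl (c ^ (n + m + k)) (d ^ (n + m + k)) := by
    refine isCompl_iff_mul_eq_bot.2 ⟨codisjoint_pow hcd _ _, le_bot_iff.1 ?_⟩
    rw [← mul_pow]
    exact (pow_antitone' _ (by lia)).trans hk
  exact ⟨_, _, hcompl, (pow_antitone' c (by lia)).trans hn,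
    (pow_antitone' d (by lia)).trans hm⟩

end Radical

namespace RadicalElements

variable {A : Type*} [CompleteLattice A] [CommMonoid A]

/-- The radical of an element of `A`, as an element of `R(A)`. -/
def ofElement (a : A) : RadicalElements A := ⟨rad a, rad_rad a⟩

theorem gc_ofElement_val :
    GaloisConnection (ofElement : A → RadicalElements A) Subtype.val :=
  fun a x => ⟨(le_rad a).trans, fun h => (rad_mono h).trans x.2.le⟩

theorem ofElement_val (x : RadicalElements A) : ofElement x.1 = x := Subtype.ext x.2

variable [IsCoherentQuantale A]

theorem codisjoint_iff_val {x y : RadicalElements A} :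
    Codisjoint x y ↔ Codisjoint x.1 y.1 := by
  rw [codisjoint_iff, codisjoint_iff, ← rad_eq_top_iff (a := x.1 ⊔ y.1)]
  exact Subtype.ext_iff

theorem isCompactElement_ofElement {c : A} (hc : IsCompactElement c) :
    IsCompactElement (ofElement c) := by
  rw [CompleteLattice.isCompactElement_iff_le_of_directed_sSup_le]
  intro S hne hdir hle
  obtain ⟨n, hn⟩ := (le_rad_iff_exists_pow_le hc).1 ((gc_ofElement_val _ _).1 hle)
  have hdir' : DirectedOn (· ≤ ·) (Subtype.val '' S) := directedOn_image.2 hdir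
  obtain ⟨_, ⟨s, hs, rfl⟩, hcs⟩ :=
    isCompactElement_pow hc n _ _ (hne.image _) hdir' (isLUB_sSup _) hn
  exact ⟨s, hs, (gc_ofElement_val _ _).2 ((le_rad_of_pow_le hcs).trans s.2.le)⟩

theorem isCompactElement_top : IsCompactElement (⊤ : RadicalElements A) := by
  rw [← ofElement_val ⊤]
  exact isCompactElement_ofElement IsCoherentQuantale.isCompactElement_top

instance : IsCompactlyGenerated (RadicalElements A) where
  exists_sSup_eq x := by
    refine ⟨ofElement '' {c | IsCompactElement c ∧ c ≤ x.1}, ?_, ?_⟩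
    · rintro _ ⟨c, hc, rfl⟩
      exact isCompactElement_ofElement hc.1
    · rw [sSup_image, ← gc_ofElement_val.l_sSup, sSup_compact_le_eq, ofElement_val]

theorem isCompl_ofElement {e f : A} (h : IsCompl e f) : IsCompl (ofElement e) (ofElement f) := by
  refine ⟨disjoint_iff.2 (Subtype.ext ?_), codisjoint_iff_val.2 ?_⟩
  · calc rad e ⊓ rad f = rad (e * f) := (rad_mul e f).symm
      _ = rad ⊥ := by rw [mul_eq_bot_of_disjoint h.disjoint]
  · exact h.codisjoint.mono (le_rad e) (le_rad f)

theorem splitsCodisjoint_iff : SplitsCodisjoint (RadicalElements A) ↔ SplitsCodisjoint A := by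
  constructor
  · intro hR a b hab
    obtain ⟨x, y, hxy, hxa, hyb⟩ := hR (codisjoint_iff_val.2
      (hab.mono (le_rad a) (le_rad b)) : Codisjoint (ofElement a) (ofElement b))
    have hbot : x.1 * y.1 ≤ rad ⊥ := (mul_le_inf _ _).trans hxy.disjoint.le_bot
    exact exists_isCompl_le_of_le_rad (codisjoint_iff_val.1 hxy.codisjoint) hbot hxa hyb
  · intro hA x y hxy
    obtain ⟨e, f, hef, hex, hfy⟩ := hA (codisjoint_iff_val.1 hxy)
    exact ⟨_, _, isCompl_ofElement hef, (gc_ofElement_val _ _).2 hex,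
      (gc_ofElement_val _ _).2 hfy⟩

end RadicalElements

namespace Reticulation

variable {A : Type*} [CompleteLattice A] [CommMonoid A] [IsCoherentQuantale A]

theorem lam_le_lam_iff {a b : Compacts A} : lam a ≤ lam b ↔ a.1 ≤ rad b.1 := by
  refine (isReticulation.le_iff a b).trans ⟨fun ⟨_, _, h⟩ => le_rad_of_pow_le h, fun h => ?_⟩
  obtain ⟨n, hn⟩ := (le_rad_iff_exists_pow_le a.2).1 h
  exact ⟨n + 1, n.succ_pos, (pow_antitone' _ n.le_succ).trans hn⟩

theorem codisjoint_lam_iff {a b : Compacts A} :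
    Codisjoint (lam a) (lam b) ↔ Codisjoint a.1 b.1 := by
  have h : ⊤ ≤ lam a ⊔ lam b ↔ ⊤ ≤ rad (a.1 ⊔ b.1) :=
    lam_le_lam_iff (a := ⟨⊤, IsCoherentQuantale.isCompactElement_top⟩) (b := a.sup b)
  rw [codisjoint_iff_le_sup, h, top_le_iff, rad_eq_top_iff, codisjoint_iff]

theorem disjoint_lam_iff {a b : Compacts A} :
    Disjoint (lam a) (lam b) ↔ a.1 * b.1 ≤ rad ⊥ :=
  disjoint_iff_inf_le.trans (lam_le_lam_iff (a := a.mul b) (b := ⟨⊥, isCompactElement_bot'⟩))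

theorem splitsCodisjoint_iff : SplitsCodisjoint (Reticulation A) ↔ SplitsCodisjoint A := by
  have htop : IsCompactElement (⊤ : A) := IsCoherentQuantale.isCompactElement_top
  constructor
  · intro hL a b hab
    obtain ⟨c, d, hc, hd, hca, hdb, hcd⟩ := exists_isCompactElement_codisjoint_pair htop hab
    obtain ⟨x, y, hxy, hxc, hyd⟩ := hL (codisjoint_lam_iff (a := ⟨c, hc⟩) (b := ⟨d, hd⟩).2 hcd)
    obtain ⟨e, rfl⟩ := isReticulation.surjective x
    obtain ⟨f, rfl⟩ := isReticulation.surjective y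
    exact exists_isCompl_le_of_le_rad (codisjoint_lam_iff.1 hxy.codisjoint)
      (disjoint_lam_iff.1 hxy.disjoint) ((lam_le_lam_iff.1 hxc).trans (rad_mono hca))
      ((lam_le_lam_iff.1 hyd).trans (rad_mono hdb))
  · intro hA x y hxy
    obtain ⟨c, rfl⟩ := isReticulation.surjective x
    obtain ⟨d, rfl⟩ := isReticulation.surjective y
    obtain ⟨e, f, hef, hec, hfd⟩ := hA (codisjoint_lam_iff.1 hxy)
    let e' : Compacts A := ⟨e, isCompactElement_of_isComplemented htop ⟨f, hef⟩⟩
    let f' : Compacts A := ⟨f, isCompactElement_of_isComplemented htop ⟨e, hef.symm⟩⟩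
    have hdisj : Disjoint (lam e') (lam f') :=
      disjoint_lam_iff.2 ((mul_eq_bot_of_disjoint hef.disjoint).le.trans bot_le)
    exact ⟨lam e', lam f', ⟨hdisj, codisjoint_lam_iff.2 hef.codisjoint⟩,
      lam_le_lam_iff.2 (hec.trans (le_rad _)), lam_le_lam_iff.2 (hfd.trans (le_rad _))⟩

end Reticulation

section Spectra

variable {A : Type*} [CompleteLattice A] [CommMonoid A] [IsIntegralQuantale A]

theorem isClopen_D {e : A} (he : IsComplemented e) : IsClopen (D e) := by
  obtain ⟨f, hef⟩ := he
  have hcompl : (D e)ᶜ = D f :=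
    Set.ext fun p => not_not.trans (p.2.not_le_iff_of_isCompl hef.symm).symm
  exact ⟨⟨f, hcompl⟩, e, rfl⟩

namespace MaxSpec

theorem isOpen_iff {U : Set (MaxSpec A)} : IsOpen U ↔ ∃ a : A, U = toPrimeSpec ⁻¹' D a := by
  constructor
  · rintro ⟨_, ⟨a, rfl⟩, rfl⟩
    exact ⟨a, rfl⟩
  · rintro ⟨a, rfl⟩
    exact ⟨D a, ⟨a, rfl⟩, rfl⟩

theorem compactSpace (htop : IsCompactElement (⊤ : A)) : CompactSpace (MaxSpec A) := by
  have : IsCoatomic A := CompleteLattice.coatomic_of_top_compact htop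
  refine ⟨isCompact_of_finite_subcover fun {ι} U hU hcover => ?_⟩
  choose a ha using fun i => isOpen_iff.1 (hU i)
  have hsup : ⊤ ≤ ⨆ i, a i := by
    refine ((eq_top_or_exists_le_coatom (⨆ i, a i)).resolve_right ?_).ge
    rintro ⟨m, hm, hle⟩
    obtain ⟨i, hi⟩ := Set.mem_iUnion.1 (hcover (Set.mem_univ (⟨m, hm⟩ : MaxSpec A)))
    rw [ha i] at hi
    exact hi ((le_iSup a i).trans hle)
  obtain ⟨t, ht⟩ := CompleteLattice.IsCompactElement.exists_finset_of_le_iSup _ htop a hsup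
  refine ⟨t, fun m _ => ?_⟩
  by_contra hm
  refine m.2.1 (top_le_iff.1 (ht.trans (iSup₂_le fun i hi => ?_)))
  by_contra him
  exact hm (Set.mem_iUnion₂.2 ⟨i, hi, (ha i).symm ▸ him⟩)

variable (A) in
/-- The family `D(e) ∩ Max(A)`, for `e ∈ B(A)`, of subsets of `Max_Z(A)`. -/
def complementedOpens : Set (Set (MaxSpec A)) :=
  {U | ∃ e : A, IsComplemented e ∧ U = toPrimeSpec ⁻¹' D e}

end MaxSpec

theorem SplitsCodisjoint.isTopologicalBasis_complementedOpens (hA : SplitsCodisjoint A) :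
    IsTopologicalBasis (MaxSpec.complementedOpens A) := by
  refine isTopologicalBasis_of_isOpen_of_nhds ?_ fun p U hp hU => ?_
  · rintro _ ⟨e, -, rfl⟩
    exact MaxSpec.isOpen_iff.2 ⟨e, rfl⟩
  · obtain ⟨a, rfl⟩ := MaxSpec.isOpen_iff.1 hU
    have hpa : Codisjoint p.1 a := codisjoint_iff.2 (p.2.2 _ (left_lt_sup.2 hp))
    obtain ⟨e, f, hef, hep, hfa⟩ := hA hpa
    exact ⟨_, ⟨f, ⟨e, hef.symm⟩, rfl⟩,
      (isMPrime_of_isCoatom p.2).not_le_of_codisjoint hef.codisjoint hep,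
      fun _ hm ham => hm (hfa.trans ham)⟩

theorem separatesCoatoms_of_isTopologicalBasis_complementedOpens
    (h : IsTopologicalBasis (MaxSpec.complementedOpens A)) : SeparatesCoatoms A := by
  intro p q hp hq hpq
  have hqp : ¬ q ≤ p := fun hle => hpq ((hq.le_iff.1 hle).resolve_left hp.1)
  obtain ⟨_, ⟨f, ⟨e, hfe⟩, rfl⟩, hfp, hsub⟩ := h.exists_subset_of_mem_open
    (a := (⟨p, hp⟩ : MaxSpec A)) hqp (MaxSpec.isOpen_iff.2 ⟨q, rfl⟩)
  have hfq : f ≤ q := by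
    by_contra hfq
    exact hsub (a := ⟨q, hq⟩) hfq le_rfl
  exact ⟨e, f, hfe.symm, ((isMPrime_of_isCoatom hp).not_le_iff_of_isCompl hfe).1 hfp, hfq⟩

theorem IsNormalQuantale.isClopen_iff [IsCoatomic A] (hA : IsNormalQuantale A)
    {U : Set (MaxSpec A)} : IsClopen U ↔ U ∈ MaxSpec.complementedOpens A := by
  constructor
  · rintro ⟨hclosed, hopen⟩
    obtain ⟨a, ha⟩ := MaxSpec.isOpen_iff.1 hopen
    obtain ⟨b, hb⟩ := MaxSpec.isOpen_iff.1 hclosed.isOpen_compl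
    have mem_iff : ∀ m : MaxSpec A, m ∈ U ↔ ¬ a ≤ m.1 := fun m => Set.ext_iff.1 ha m
    have mem_iff' : ∀ m : MaxSpec A, m ∈ U ↔ b ≤ m.1 := fun m =>
      not_iff_not.1 (Set.ext_iff.1 hb m)
    have hab : Codisjoint a b := codisjoint_iff_forall_isCoatom.2 fun m hm ham hbm =>
      (mem_iff ⟨m, hm⟩).1 ((mem_iff' ⟨m, hm⟩).2 hbm) ham
    obtain ⟨g, h, hag, hbh, hgh⟩ := hA a b hab.eq_top
    have hbU : ∀ m : MaxSpec A, m ∈ U → ¬ h ≤ m.1 := fun m hm =>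
      (isMPrime_of_isCoatom m.2).not_le_of_codisjoint (codisjoint_iff.2 hbh) ((mem_iff' m).1 hm)
    have haU : ∀ m : MaxSpec A, g ≤ m.1 → m ∈ U := fun m hg => (mem_iff m).2
      ((isMPrime_of_isCoatom m.2).not_le_of_codisjoint (codisjoint_iff.2 hag).symm hg)
    have hcompl : IsCompl g h := isCompl_iff_mul_eq_bot.2
      ⟨codisjoint_iff_forall_isCoatom.2 fun m hm hg => hbU ⟨m, hm⟩ (haU ⟨m, hm⟩ hg), hgh⟩
    refine ⟨h, ⟨g, hcompl.symm⟩, Set.ext fun m => ⟨hbU m, fun hm => haU m ?_⟩⟩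
    exact ((isMPrime_of_isCoatom m.2).not_le_iff_of_isCompl hcompl.symm).1 hm
  · rintro ⟨e, he, rfl⟩
    exact (isClopen_D he).preimage continuous_induced_dom

theorem IsNormalQuantale.isZeroDimensional_iff [IsCoatomic A] (hA : IsNormalQuantale A) :
    IsZeroDimensional (MaxSpec A) ↔ IsTopologicalBasis (MaxSpec.complementedOpens A) := by
  have h : {U : Set (MaxSpec A) | IsClopen U} = MaxSpec.complementedOpens A :=
    Set.ext fun _ => hA.isClopen_iff
  rw [IsZeroDimensional, h]

namespace MaxSpec

theorem continuous_pierceMap : Continuous fun m : MaxSpec A => pierceMap m.toPrimeSpec := by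
  refine continuous_generateFrom_iff.2 ?_
  rintro _ ⟨e, he, rfl⟩
  exact isOpen_iff.2 ⟨e, Set.ext fun m => not_congr (le_regularPart_iff he)⟩

theorem surjective_pierceMap [IsCoatomic A] :
    Function.Surjective fun m : MaxSpec A => pierceMap m.toPrimeSpec := by
  rintro ⟨q, hq⟩
  obtain ⟨m, hm, hqm⟩ := (eq_top_or_exists_le_coatom q).resolve_left hq.prop.2
  have hle : q ≤ regularPart m := by
    obtain ⟨S, hS, rfl⟩ := hq.prop.1
    exact sSup_le fun e he => (le_regularPart_iff (hS e he)).2 ((le_sSup he).trans hqm)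
  have heq := hq.eq_of_le (maximal_regularPart (isMPrime_of_isCoatom hm)).prop hle
  exact ⟨⟨m, hm⟩, Subtype.ext heq.symm⟩

theorem injective_pierceMap_iff :
    (Function.Injective fun m : MaxSpec A => pierceMap m.toPrimeSpec) ↔ SeparatesCoatoms A := by
  constructor
  · intro h p q hp hq hpq
    refine ((isMPrime_of_isCoatom hp).exists_isCompl_le_iff (isMPrime_of_isCoatom hq)).2 ?_
    exact fun heq => hpq (congrArg Subtype.val (@h ⟨p, hp⟩ ⟨q, hq⟩ (Subtype.ext heq)))
  · intro hA p q heq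
    by_contra hpq
    exact ((isMPrime_of_isCoatom p.2).exists_isCompl_le_iff (isMPrime_of_isCoatom q.2)).1
      (hA p.1 q.1 p.2 q.2 (Subtype.coe_ne_coe.2 hpq)) (congrArg Subtype.val heq)

end MaxSpec

instance [IsCoatomic A] : T2Space (PierceSpec A) := by
  refine ⟨fun x y hxy => ?_⟩
  obtain ⟨p, rfl⟩ := MaxSpec.surjective_pierceMap x
  obtain ⟨q, rfl⟩ := MaxSpec.surjective_pierceMap y
  have hp := isMPrime_of_isCoatom p.2
  have hq := isMPrime_of_isCoatom q.2
  obtain ⟨e, f, hef, hep, hfq⟩ :=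
    (hp.exists_isCompl_le_iff hq).2 fun heq => hxy (Subtype.ext heq)
  have he : IsComplemented e := ⟨f, hef⟩
  have hf : IsComplemented f := ⟨e, hef.symm⟩
  refine ⟨_, _, isOpen_generateFrom_of_mem ⟨f, hf, rfl⟩, isOpen_generateFrom_of_mem ⟨e, he, rfl⟩,
    fun h => ?_, fun h => ?_, Set.disjoint_left.2 fun z hfz hez => ?_⟩
  · exact hp.not_le_of_codisjoint hef.codisjoint hep ((le_regularPart_iff hf).1 h)
  · exact hq.not_le_of_codisjoint hef.symm.codisjoint hfq ((le_regularPart_iff he).1 h)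
  · obtain ⟨m, rfl⟩ := MaxSpec.surjective_pierceMap z
    refine hfz ((le_regularPart_iff hf).2 ?_)
    exact ((isMPrime_of_isCoatom m.2).not_le_iff_of_isCompl hef).1
      fun h => hez ((le_regularPart_iff he).2 h)

theorem SeparatesCoatoms.isBooleanSpace (htop : IsCompactElement (⊤ : A))
    (hA : SeparatesCoatoms A) : IsBooleanSpace (MaxSpec A) := by
  have : IsCoatomic A := CompleteLattice.coatomic_of_top_compact htop
  have hsplit : SplitsCodisjoint A := hA.splitsCodisjoint htop
  exact ⟨MaxSpec.compactSpace htop,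
    .of_injective_continuous (MaxSpec.injective_pierceMap_iff.2 hA) MaxSpec.continuous_pierceMap,
    hsplit.isNormalQuantale.isZeroDimensional_iff.2 hsplit.isTopologicalBasis_complementedOpens⟩

theorem isHomeomorph_pierceMap_iff_separatesCoatoms (htop : IsCompactElement (⊤ : A)) :
    (IsHomeomorph fun m : MaxSpec A => pierceMap m.toPrimeSpec) ↔ SeparatesCoatoms A := by
  have : IsCoatomic A := CompleteLattice.coatomic_of_top_compact htop
  have : CompactSpace (MaxSpec A) := MaxSpec.compactSpace htop
  rw [isHomeomorph_iff_continuous_bijective, Function.Bijective, MaxSpec.injective_pierceMap_iff]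
  exact ⟨fun h => h.2.1, fun h => ⟨MaxSpec.continuous_pierceMap, h, MaxSpec.surjective_pierceMap⟩⟩

end Spectra

end CohQuantale

open CohQuantale in
theorem theorem7p13 (A : Type*) [CompleteLattice A] [CommMonoid A]
    [CohQuantale.IsCoherentQuantale A] :
    List.TFAE [
      CohQuantale.IsBNormalQuantale A,
      CohQuantale.IsBNormalQuantale (CohQuantale.RadicalElements A),
      CohQuantale.IsBNormalLattice (CohQuantale.Reticulation A),
      ∀ p q : A, IsCoatom p → IsCoatom q → p ≠ q →
        ∃ e f : A, IsCompl e f ∧ e ≤ p ∧ f ≤ q,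
      CohQuantale.IsNormalQuantale A ∧ CohQuantale.IsZeroDimensional (CohQuantale.MaxSpec A),
      CohQuantale.IsNormalQuantale A ∧ CohQuantale.IsBooleanSpace (CohQuantale.MaxSpec A),
      TopologicalSpace.IsTopologicalBasis
        {U : Set (CohQuantale.MaxSpec A) | ∃ e : A, IsComplemented e ∧
          U = CohQuantale.MaxSpec.toPrimeSpec ⁻¹' CohQuantale.D e},
      IsHomeomorph
        (fun m : CohQuantale.MaxSpec A => CohQuantale.pierceMap m.toPrimeSpec)] := by
  have htop : IsCompactElement (⊤ : A) := IsCoherentQuantale.isCompactElement_top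
  have hsplit : SplitsCodisjoint A ↔ SeparatesCoatoms A :=
    splitsCodisjoint_iff_separatesCoatoms htop
  tfae_have 1 ↔ 4 := (isBNormalQuantale_iff_splitsCodisjoint htop).trans hsplit
  tfae_have 2 ↔ 4 :=
    (isBNormalQuantale_iff_splitsCodisjoint RadicalElements.isCompactElement_top).trans
      (RadicalElements.splitsCodisjoint_iff.trans hsplit)
  tfae_have 3 ↔ 4 :=
    isBNormalLattice_iff_splitsCodisjoint.trans (Reticulation.splitsCodisjoint_iff.trans hsplit)
  tfae_have 4 → 6 := fun h =>
    ⟨(hsplit.2 h).isNormalQuantale, SeparatesCoatoms.isBooleanSpace htop h⟩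
  tfae_have 6 → 5 := fun ⟨hnormal, _, _, hzero⟩ => ⟨hnormal, hzero⟩
  tfae_have 5 → 7 := fun ⟨hnormal, hzero⟩ => hnormal.isZeroDimensional_iff.1 hzero
  tfae_have 7 → 4 := separatesCoatoms_of_isTopologicalBasis_complementedOpens
  tfae_have 8 ↔ 4 := isHomeomorph_pierceMap_iff_separatesCoatoms htop
  tfae_finish
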